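/- Let $\Sigma$ be a finite alphabet. All languages are sets of nonempty words over $\Sigma$. For every language $L\subseteq\Sigma^+$, $L$ is accepted in real time by an iterative array if and only if $L$ is defined by a predecessor Horn formula with diagonal input-output; that is, $$\mathtt{RealTime_{IA}}=\mathtt{pred}\text{-}\mathtt{dio}\text{-}\mathtt{ESO}\text{-}\mathtt{HORN}.$$ *Iterative arrays.* An iterative array (IA) has a finite state set $Q$ with a set $Q_{accept}\subseteq Q$ of accepting states, two distinct distinguished states $\sharp$ (permanent) and $\lambda$ (quiescent), a transition function $\delta:Q^3\to Q$ with $\delta(\lambda,\lambda,\lambda)=\delta(\lambda,\lambda,\sharp)=\lambda$, and an input transition function $\delta_{input}:\Sigma\times Q^3\to Q$. On an input $w=w_1\dots w_n$, $n\ge 1$, the state $\langle c,t\rangle$ of cell $c\in\mathbb Z$ at time $t\ge 0$ is: $\langle c,t\rangle=\sharp$ for $c\notin[1,n]$; $\langle c,0\rangle=\lambda$ for $c\in[1,n]$; $\langle 1,t\rangle=\delta_{input}(w_t,\langle 0,t-1\rangle,\langle 1,t-1\rangle,\langle 2,t-1\rangle)$ for $1\le t\le n$; and $\langle c,t\rangle=\delta(\langle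 c-1,t-1\rangle,\langle c,t-1\rangle,\langle c+1,t-1\rangle)$ for all other $c\in[1,n]$, $t\ge 1$. The language accepted in real time is the set of all $w\in\Sigma^+$ such that $\langle 1,n\rangle\in Q_{accept}$, where $n=|w|$. $\mathtt{RealTime_{IA}}$ is the class of the languages accepted in real time by iterative arrays. *Logic.* A word $w=w_1\dots w_n$, $n\ge1$, is encoded by the structure $\langle w\rangle$ of domain $[1,n]$ with the monadic predicates $Q_s(i)\iff w_i=s$ ($s\in\Sigma$), $\mathtt{min}(i)\iff i=1$, $\mathtt{max}(i)\iff i=n$, and the predecessor function with $\mathtt{pred}(i)=i-1$ for $i>1$ and $\mathtt{pred}(1)=1$; $v-a$ denotes $\mathtt{pred}^a(v)$. A predecessor Horn formula with diagonal input-output is a formula $\exists\mathbf R\,\forall x\,\forall y\,\psi(x,y)$, where $\mathbf R$ is a finite set of binary predicates and $\psi$ is a finite conjunction of clauses $\delta_1\wedge\dots\wedge\delta_r\to\delta_0$ in which $\delta_0$ is $R(x,y)$ with $R\in\mathbf R$, or $\bot$, and each $\delta_i$, $i\ge1$, has one of the following forms, with integers $a,b\ge 0$: $Q_s(x-a)\wedge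 x=y$ with $s\in\Sigma$; $U(x-a)$, $\neg U(x-a)$, $U(y-a)$ or $\neg U(y-a)$ with $U\in\{\mathtt{min},\mathtt{max}\}$; $S(x-a,y-b)$ or $S(y-b,x-a)$ with $S\in\mathbf R$. It defines the language of all $w\in\Sigma^+$ such that $\langle w\rangle$ satisfies it, and $\mathtt{pred}$-$\mathtt{dio}$-$\mathtt{ESO}$-$\mathtt{HORN}$ is the class of the languages so defined. -/

import Mathlib

/-! ### Iterative arrays working in real time -/

/-- A one-dimensional iterative array over the input alphabet `A`: finite state set, permanent
state `sharp` (outside the array), quiescent state `quiescent`, accepting states, neighborhood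
`{-1, 0, 1}` and two transition functions, whose state arguments are the states of the left
neighbor, of the cell itself and of the right neighbor at the previous time step.
`delta` is the ordinary transition function; `deltaInput` is the transition function of the first
cell while it is fed with the letters of the input. -/
structure IterativeArray (A : Type*) where
  State : Type
  finite_state : Finite State
  sharp : State
  quiescent : State
  sharp_ne_quiescent : sharp ≠ quiescent
  accept : Set State
  delta : State → State → State → State
  deltaInput : A → State → State → State → State
  /-- A cell stays quiescent as long as no information from the input has reached it. -/
  delta_quiescent : delta quiescent quiescent quiescent = quiescent
  /-- The same for the last cell, whose right neighbor is outside the array. -/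
  delta_quiescent_border : delta quiescent quiescent sharp = quiescent

namespace IterativeArray

variable {A : Type*} (M : IterativeArray A)

/-- `M.state w t c` is the state of the cell `c` at time `t` on the input `w` of length `n`.
The cells outside `[1, n]` are always in the state `sharp`; before the first letter is read (time
`0`) the cells of `[1, n]` are quiescent; for `1 ≤ i ≤ n` the `i`-th letter is given to the first
cell at time `i`. -/
def state (w : List A) : ℕ → ℤ → M.State
  | 0, c => if 1 ≤ c ∧ c ≤ (w.length : ℤ) then M.quiescent else M.sharp
  | t + 1, c =>
    if 1 ≤ c ∧ c ≤ (w.length : ℤ) then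
      match w[t]?, decide (c = 1) with
      | some a, true =>
        M.deltaInput a (state w t (c - 1)) (state w t c) (state w t (c + 1))
      | _, _ => M.delta (state w t (c - 1)) (state w t c) (state w t (c + 1))
    else M.sharp

/-- The language accepted in real time: the nonempty words `w` such that the first cell is in an
accepting state at time `|w|`, that is, immediately when it gets the last letter of `w`. -/
def realTimeLanguage : Language A :=
  {w | w ≠ [] ∧ M.state w w.length 1 ∈ M.accept}

end IterativeArray

/-- The class of languages of nonempty words over `A` accepted by iterative arrays in real time. -/
def RealTimeIA (A : Type*) : Set (Language A) :=
  {L | ∃ M : IterativeArray A, L = M.realTimeLanguage}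

/-! ### The structure encoding a word

The domain `[1, n]` is represented by `Fin n` (so the position `i` of the word is `i - 1`). -/

namespace WordStructure

variable {A : Type*} (w : List A)

/-- `Q_s(i)`: the letter at position `i` is `s`. -/
def Letter (s : A) (i : Fin w.length) : Prop := w.get i = s

/-- `min(i)`: `i` is the first position. -/
def IsMin (i : Fin w.length) : Prop := (i : ℕ) = 0

/-- `max(i)`: `i` is the last position. -/
def IsMax (i : Fin w.length) : Prop := (i : ℕ) + 1 = w.length

/-- The predecessor function; the predecessor of the first position is the first position. -/
def pred (i : Fin w.length) : Fin w.length :=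
  ⟨(i : ℕ) - 1, lt_of_le_of_lt (Nat.sub_le _ _) i.isLt⟩

/-- The value of the term `i - a`, the `a`-fold iterate of the predecessor function. -/
def sub (i : Fin w.length) (a : ℕ) : Fin w.length := (pred w)^[a] i

end WordStructure

/-! ### Predecessor Horn formulas with diagonal input-output -/

/-- The two first-order variables. -/
inductive HornVar
  | x
  | y

/-- The two input predicates `min` and `max`. -/
inductive Extremum
  | min
  | max

/-- The hypotheses that may occur in a clause of a predecessor Horn formula with diagonal
input-output, where `A` is the alphabet and `P` the set of computation predicates. -/
inductive DioHyp (A : Type*) (P : Type)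
  /-- `Q_s(x - a) ∧ x = y` -/
  | letter (s : A) (a : ℕ)
  /-- `U(v - a)` for `U ∈ {min, max}` and `v ∈ {x, y}` -/
  | pos (U : Extremum) (v : HornVar) (a : ℕ)
  /-- `¬ U(v - a)` for `U ∈ {min, max}` and `v ∈ {x, y}` -/
  | neg (U : Extremum) (v : HornVar) (a : ℕ)
  /-- `S(x - a, y - b)` -/
  | comp (S : P) (a b : ℕ)
  /-- `S(y - b, x - a)` -/
  | compSwap (S : P) (b a : ℕ)

/-- The conclusion of a clause. -/
inductive DioConclusion (P : Type)
  /-- `R(x, y)` -/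
  | atom (R : P)
  /-- `⊥` -/
  | falsum

/-- A Horn clause `δ₁ ∧ ... ∧ δᵣ → δ₀`. -/
structure DioClause (A : Type*) (P : Type) where
  hyps : List (DioHyp A P)
  concl : DioConclusion P

/-- A predecessor Horn formula with diagonal input-output `∃ R, ∀ x, ∀ y, ψ(x, y)`: a finite set of
binary computation predicates, and a finite conjunction `ψ` of clauses. -/
structure DioFormula (A : Type*) where
  Pred : Type
  finite_pred : Finite Pred
  clauses : List (DioClause A Pred)

section Semantics

variable {A : Type*} {P : Type} (w : List A)

/-- The truth of `U(i)` for `U ∈ {min, max}`. -/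
def Extremum.Holds (i : Fin w.length) : Extremum → Prop
  | .min => WordStructure.IsMin w i
  | .max => WordStructure.IsMax w i

/-- The value of a variable. -/
def HornVar.value {D : Type} (i j : D) : HornVar → D
  | .x => i
  | .y => j

/-- The truth of a hypothesis for `x = i` and `y = j`, the computation predicates being
interpreted by `R`. -/
def DioHyp.Holds (R : P → Fin w.length → Fin w.length → Prop) (i j : Fin w.length) :
    DioHyp A P → Prop
  | .letter s a => WordStructure.Letter w s (WordStructure.sub w i a) ∧ i = j
  | .pos U v a => U.Holds w (WordStructure.sub w (v.value i j) a)
  | .neg U v a => ¬ U.Holds w (WordStructure.sub w (v.value i j) a)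
  | .comp S a b => R S (WordStructure.sub w i a) (WordStructure.sub w j b)
  | .compSwap S b a => R S (WordStructure.sub w j b) (WordStructure.sub w i a)

/-- The truth of a conclusion. -/
def DioConclusion.Holds (R : P → Fin w.length → Fin w.length → Prop) (i j : Fin w.length) :
    DioConclusion P → Prop
  | .atom S => R S i j
  | .falsum => False

/-- The truth of a clause. -/
def DioClause.Holds (R : P → Fin w.length → Fin w.length → Prop) (i j : Fin w.length)
    (C : DioClause A P) : Prop :=
  (∀ h ∈ C.hyps, h.Holds w R i j) → C.concl.Holds w R i j

/-- The structure encoding `w` satisfies the formula `Φ`. -/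
def DioFormula.Satisfied (Φ : DioFormula A) : Prop :=
  ∃ R : Φ.Pred → Fin w.length → Fin w.length → Prop,
    ∀ i j : Fin w.length, ∀ C ∈ Φ.clauses, C.Holds w R i j

end Semantics

/-- The language of nonempty words defined by a formula. -/
def DioFormula.language {A : Type*} (Φ : DioFormula A) : Language A :=
  {w | w ≠ [] ∧ Φ.Satisfied w}

/-- The class `pred-dio-ESO-HORN` of languages of nonempty words over `A`. -/
def PredDioESOHorn (A : Type*) : Set (Language A) :=
  {L | ∃ Φ : DioFormula A, L = Φ.language}

/-! Between the two classes stands a finite-state circuit on the triangle of the points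
`1 ≤ x ≤ y`, reading the input on the diagonal. The change of coordinates `x = t - c`, `y = t + c`
turns the neighborhood of an iterative array into the dependencies of such a circuit, and a circuit
is described by a formula with a predicate for each state.

Conversely, fold the square along its diagonal, so that the atoms at `(x, y)` and `(y, x)` are
considered together. The atoms of the least model of a Horn formula at a point are then determined
by those at boundedly many preceding points, by the letters read nearby if the point is on the
diagonal, and by `min` and `max`. These data fit into a finite state. The only nonlocal one is
`max`: the circuit does not know whether the row `y` is the last one, so it computes the least model
in both cases, and `⊥` is propagated upwards so that it is visible at the last point. -/

/-! ### Diagonal grids -/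

/-- A finite-state circuit on the triangle of the points `(x, y)` with `1 ≤ x ≤ y`, an intermediate
device between iterative arrays and formulas. The state at `(x, y)` is computed from the states at
`(x - 1, y)` and `(x, y - 1)` if `x < y`, and from the state at `(x - 1, x)` and the `x`-th letter
if `x = y`; the left neighbor is `none` in the first column `x = 1`. -/
structure DiagonalGrid (A : Type*) where
  State : Type
  finite_state : Finite State
  inner : Option State → State → State
  diag : A → Option State → State
  accept : Set State

namespace DiagonalGrid

variable {A : Type*} (G : DiagonalGrid A)

/-- The state at a point above the diagonal, given the states at its two predecessors. -/
def step (left below : Option G.State) : Option G.State :=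
  below.map (G.inner left)

/-- `G.value w x d` is the state at the point `(x, x + d)` on the input `w`; the second coordinate
is given by its distance `d` to the diagonal so that the points below the diagonal do not occur. The
state is `none` in the added column `x = 0` and in the columns `x > |w|`. -/
def value (w : List A) : ℕ → ℕ → Option G.State
  | 0, _ => none
  | x + 1, 0 => w[x]?.map fun a => G.diag a (value w x 1)
  | x + 1, d + 1 => G.step (value w x (d + 2)) (value w (x + 1) d)

/-- The words `w` with an accepting state at the point `(|w|, |w|)`. -/
def language : Language A :=
  {w | ∃ q ∈ G.accept, G.value w w.length 0 = some q}

theorem value_zero_left (w : List A) (d : ℕ) : G.value w 0 d = none := by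
  rw [value]

theorem value_succ_zero {w : List A} {x : ℕ} (hx : x < w.length) :
    G.value w (x + 1) 0 = some (G.diag w[x] (G.value w x 1)) := by
  rw [value, List.getElem?_eq_getElem hx, Option.map_some]

theorem value_succ_right (w : List A) (x d : ℕ) :
    G.value w x (d + 1) = G.step (G.value w (x - 1) (d + 2)) (G.value w x d) := by
  cases x with
  | zero =>
    rw [value_zero_left, value_zero_left, value_zero_left]
    rfl
  | succ x => rw [value, Nat.add_sub_cancel]

theorem isSome_value {w : List A} {x : ℕ} (hx : x < w.length) (d : ℕ) :
    (G.value w (x + 1) d).isSome := by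
  induction d with
  | zero => rw [value_succ_zero G hx, Option.isSome_some]
  | succ d ih => rwa [value_succ_right, step, Option.isSome_map]

end DiagonalGrid

/-- The class of languages recognized by diagonal grids. -/
def DiagonalGridLanguages (A : Type*) : Set (Language A) :=
  {L | ∃ G : DiagonalGrid A, L = G.language}

/-! ### Iterative arrays and diagonal grids -/

namespace IterativeArray

variable {A : Type*} (M : IterativeArray A)

theorem state_of_outside (w : List A) (t : ℕ) {c : ℤ} (hc : ¬ (1 ≤ c ∧ c ≤ (w.length : ℤ))) :
    M.state w t c = M.sharp := by
  cases t <;> simp only [state, if_neg hc]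

theorem state_succ_one {w : List A} {t : ℕ} (ht : t < w.length) :
    M.state w (t + 1) 1 = M.deltaInput w[t] M.sharp (M.state w t 1) (M.state w t 2) := by
  have left_outside : M.state w t (1 - 1) = M.sharp := M.state_of_outside w t (by omega)
  have inside : (1 : ℤ) ≤ 1 ∧ (1 : ℤ) ≤ (w.length : ℤ) := by omega
  rw [state, if_pos inside, left_outside, List.getElem?_eq_getElem ht]
  rfl

theorem state_succ_of_ne_one (w : List A) (t : ℕ) {c : ℤ} (hc : 1 ≤ c ∧ c ≤ (w.length : ℤ))
    (h1 : c ≠ 1) :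
    M.state w (t + 1) c =
      M.delta (M.state w t (c - 1)) (M.state w t c) (M.state w t (c + 1)) := by
  rw [state, if_pos hc]
  simp only [h1, decide_false]
  cases w[t]? <;> rfl

theorem state_eq_quiescent (w : List A) (t : ℕ) {c : ℤ} (h : (t : ℤ) < c)
    (hc : c ≤ (w.length : ℤ)) : M.state w t c = M.quiescent := by
  induction t generalizing c with
  | zero => rw [state, if_pos ⟨by omega, hc⟩]
  | succ t ih =>
    rw [state_succ_of_ne_one M w t ⟨by omega, hc⟩ (by omega), ih (by omega) (by omega),
      ih (by omega) hc]
    by_cases hn : c + 1 ≤ (w.length : ℤ)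
    · rw [ih (by omega) hn, M.delta_quiescent]
    · rw [state_of_outside M w t (by omega), M.delta_quiescent_border]

/-- The information on a computation of `M` stored at the points `(x, x + d)` of a diagonal grid.
If `d = 2 * c`, then `cell` is the state of the cell `c + 1` at time `x + c`; if `d = 2 * c + 1`,
then `left` and `right` are the states of the cells `c + 1` and `c + 2` at time `x + c`. The grid
does not know the parity of `d`, so it computes all the fields everywhere. On the diagonal, `final`
is the state of the first cell at time `x` if the word has length `x`. -/
structure Snapshot where
  cell : M.State
  left : M.State
  right : M.State
  final : M.State

instance : Finite M.Snapshot := by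
  have := M.finite_state
  refine Finite.of_injective (fun s : M.Snapshot => (s.cell, s.left, s.right, s.final)) ?_
  rintro ⟨⟩ ⟨⟩ h
  simpa using h

/-- The snapshot in the added column `x = 0`, which no information from the input has reached. -/
def quiescentSnapshot : M.Snapshot where
  cell := M.quiescent
  left := M.quiescent
  right := M.quiescent
  final := M.quiescent

/-- The diagonal grid simulating `M`. In a word of length `1`, and only there, the second cell is
outside of the array when the last letter is read, whence the two values for a missing left
neighbor in `diag`. -/
def toGrid : DiagonalGrid A where
  State := M.Snapshot
  finite_state := inferInstance
  inner u s :=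
    let r := u.getD M.quiescentSnapshot
    { cell := M.delta s.left s.right r.right
      left := s.cell
      right := r.cell
      final := M.quiescent }
  diag a u :=
    let r := u.getD M.quiescentSnapshot
    { cell := M.deltaInput a M.sharp r.left r.right
      left := M.quiescent
      right := M.quiescent
      final := M.deltaInput a M.sharp r.left (u.elim M.sharp Snapshot.right) }
  accept := {s | s.final ∈ M.accept}

/-- The snapshot stored at `(x, x + d)`. -/
def snapshot (w : List A) (x d : ℕ) : M.Snapshot :=
  (M.toGrid.value w x d).getD M.quiescentSnapshot

theorem snapshot_zero_left (w : List A) (d : ℕ) : M.snapshot w 0 d = M.quiescentSnapshot := by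
  rw [snapshot, DiagonalGrid.value_zero_left]
  rfl

theorem value_toGrid_succ {w : List A} {x : ℕ} (hx : x < w.length) (d : ℕ) :
    M.toGrid.value w (x + 1) d = some (M.snapshot w (x + 1) d) := by
  obtain ⟨s, hs⟩ := Option.isSome_iff_exists.1 (M.toGrid.isSome_value hx d)
  rw [snapshot, hs]
  rfl

theorem cell_snapshot_succ_zero {w : List A} {x : ℕ} (hx : x < w.length) :
    (M.snapshot w (x + 1) 0).cell =
      M.deltaInput w[x] M.sharp (M.snapshot w x 1).left (M.snapshot w x 1).right := by
  rw [snapshot, DiagonalGrid.value_succ_zero _ hx]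
  rfl

theorem snapshot_succ_succ {w : List A} {x : ℕ} (hx : x < w.length) (d : ℕ) :
    M.snapshot w (x + 1) (d + 1) =
      M.toGrid.inner (M.toGrid.value w x (d + 2)) (M.snapshot w (x + 1) d) := by
  rw [snapshot, DiagonalGrid.value_succ_right, value_toGrid_succ M hx]
  rfl

theorem left_snapshot_succ_succ {w : List A} {x : ℕ} (hx : x < w.length) (d : ℕ) :
    (M.snapshot w (x + 1) (d + 1)).left = (M.snapshot w (x + 1) d).cell := by
  rw [snapshot_succ_succ M hx]
  rfl

theorem right_snapshot_succ_succ {w : List A} {x : ℕ} (hx : x < w.length) (d : ℕ) :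
    (M.snapshot w (x + 1) (d + 1)).right = (M.snapshot w x (d + 2)).cell := by
  rw [snapshot_succ_succ M hx]
  rfl

theorem cell_snapshot_succ_succ {w : List A} {x : ℕ} (hx : x < w.length) (d : ℕ) :
    (M.snapshot w (x + 1) (d + 1)).cell =
      M.delta (M.snapshot w (x + 1) d).left (M.snapshot w (x + 1) d).right
        (M.snapshot w x (d + 2)).right := by
  rw [snapshot_succ_succ M hx]
  rfl

theorem snapshot_eq_state {w : List A} (hw : 2 ≤ w.length) (x c : ℕ) :
    (x + 2 * c ≤ w.length → (M.snapshot w x (2 * c)).cell = M.state w (x + c) (c + 1)) ∧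
    (x + (2 * c + 1) ≤ w.length →
      (M.snapshot w x (2 * c + 1)).left = M.state w (x + c) (c + 1) ∧
      (M.snapshot w x (2 * c + 1)).right = M.state w (x + c) (c + 2)) := by
  induction x generalizing c with
  | zero =>
    simp only [snapshot_zero_left, quiescentSnapshot]
    exact ⟨fun h => (M.state_eq_quiescent w _ (by omega) (by omega)).symm,
      fun h => ⟨(M.state_eq_quiescent w _ (by omega) (by omega)).symm,
        (M.state_eq_quiescent w _ (by omega) (by omega)).symm⟩⟩
  | succ x ih =>
    have next_right (c : ℕ) (h : x + 1 + (2 * c + 1) ≤ w.length) :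
        (M.snapshot w (x + 1) (2 * c + 1)).right = M.state w (x + 1 + c) (c + 2) := by
      rw [right_snapshot_succ_succ M (by omega)]
      refine ((ih (c + 1)).1 (by omega)).trans ?_
      congr 1
      all_goals omega
    induction c with
    | zero =>
      have cell_zero (h : x + 1 + 2 * 0 ≤ w.length) :
          (M.snapshot w (x + 1) (2 * 0)).cell = M.state w (x + 1 + 0) ((0 : ℕ) + 1) := by
        obtain ⟨left, right⟩ := (ih 0).2 (by omega)
        rw [Nat.mul_zero, cell_snapshot_succ_zero M h, left, right]
        simpa using (M.state_succ_one h).symm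
      exact ⟨cell_zero, fun h =>
        ⟨(M.left_snapshot_succ_succ (by omega) _).trans (cell_zero (by omega)), next_right 0 h⟩⟩
    | succ c ihc =>
      have cell_succ (h : x + 1 + 2 * (c + 1) ≤ w.length) :
          (M.snapshot w (x + 1) (2 * (c + 1))).cell =
            M.state w (x + 1 + (c + 1)) ((c + 1 : ℕ) + 1) := by
        obtain ⟨left, middle⟩ := ihc.2 (by omega)
        have right : (M.snapshot w x (2 * c + 1 + 2)).right = _ := ((ih (c + 1)).2 (by omega)).2
        rw [Nat.mul_succ, cell_snapshot_succ_succ M (by omega), left, middle, right,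
          ← Nat.add_assoc (x + 1), M.state_succ_of_ne_one w (x + 1 + c) (by omega) (by omega)]
        congr 2 <;> omega
      exact ⟨cell_succ, fun h =>
        ⟨(M.left_snapshot_succ_succ (by omega) _).trans (cell_succ (by omega)),
          next_right (c + 1) h⟩⟩

theorem exists_value_toGrid_length {w : List A} (hw : w ≠ []) :
    ∃ s : M.Snapshot, M.toGrid.value w w.length 0 = some s ∧ s.final = M.state w w.length 1 := by
  obtain ⟨n, hn⟩ := Nat.exists_eq_add_one.2 (List.length_pos_iff.2 hw)
  rw [hn]
  refine ⟨_, M.toGrid.value_succ_zero (by omega), ?_⟩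
  rw [M.state_succ_one (by omega)]
  cases n with
  | zero =>
    have first : M.state w 0 1 = M.quiescent := M.state_eq_quiescent w 0 (by omega) (by omega)
    have second : M.state w 0 2 = M.sharp := M.state_of_outside w 0 (by omega)
    rw [first, second, DiagonalGrid.value_zero_left]
    rfl
  | succ n =>
    obtain ⟨left, right⟩ := (M.snapshot_eq_state (w := w) (by omega) (n + 1) 0).2 (by omega)
    rw [value_toGrid_succ M (by omega)]
    exact congrArg₂ (M.deltaInput _ M.sharp) left right

theorem language_toGrid : M.toGrid.language = M.realTimeLanguage := by
  ext w
  constructor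
  · rintro ⟨s, hs, hval⟩
    have hw : w ≠ [] := by
      rintro rfl
      simp [DiagonalGrid.value_zero_left] at hval
    obtain ⟨s', hval', hs'⟩ := M.exists_value_toGrid_length hw
    obtain rfl : s' = s := Option.some_injective _ (hval'.symm.trans hval)
    exact ⟨hw, Set.mem_of_eq_of_mem hs'.symm (hs : s'.final ∈ M.accept)⟩
  · rintro ⟨hw, hacc⟩
    obtain ⟨s, hval, hs⟩ := M.exists_value_toGrid_length hw
    exact ⟨s, show s.final ∈ M.accept from hs ▸ hacc, hval⟩

end IterativeArray

namespace DiagonalGrid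

variable {A : Type*} (G : DiagonalGrid A)

/-- The iterative array simulating `G`: the cell `c + 1` at time `t` holds the value of `G` at
`(t - c, t + c)`. The permanent state is `none`, and `some none` is quiescent. -/
def toIterativeArray : IterativeArray A where
  State := Option (Option G.State)
  finite_state := have := G.finite_state; inferInstance
  sharp := none
  quiescent := some none
  sharp_ne_quiescent := by simp
  accept := {s | ∃ q ∈ G.accept, s.join = some q}
  delta l c r := some (G.step (G.step r.join c.join) (G.step c.join l.join))
  deltaInput a _ c r := some (some (G.diag a (G.step r.join c.join)))
  delta_quiescent := rfl
  delta_quiescent_border := rfl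

theorem join_state_toIterativeArray {w : List A} {t c : ℕ} (h : t + c ≤ w.length) :
    (G.toIterativeArray.state w t (c + 1)).join = G.value w (t - c) (2 * c) := by
  induction t generalizing c with
  | zero =>
    rw [Nat.zero_sub, value_zero_left, IterativeArray.state]
    split_ifs <;> rfl
  | succ t ih =>
    cases c with
    | zero =>
      have middle : (G.toIterativeArray.state w t 1).join = G.value w t 0 := ih (c := 0) (by omega)
      have right : (G.toIterativeArray.state w t 2).join = G.value w (t - 1) 2 :=
        ih (c := 1) (by omega)
      have diagonal : G.value w (t + 1) 0 = some (G.diag w[t] (G.value w t 1)) :=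
        G.value_succ_zero (by omega)
      rw [Nat.sub_zero, Nat.mul_zero, diagonal, value_succ_right, ← middle, ← right,
        Nat.cast_zero, zero_add, IterativeArray.state_succ_one _ (by omega)]
      rfl
    | succ c =>
      have left := ih (c := c) (by omega)
      have middle : (G.toIterativeArray.state w t ((c + 1 : ℕ) + 1)).join =
        G.value w (t - c - 1) (2 * c + 2) := ih (by omega)
      have right : (G.toIterativeArray.state w t ((c + 1 : ℕ) + 1 + 1)).join =
        G.value w (t - c - 1 - 1) (2 * c + 2 + 2) := ih (c := c + 2) (by omega)
      rw [Nat.add_sub_add_right, Nat.mul_succ, value_succ_right,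
        value_succ_right _ _ (t - c - 1) (2 * c + 2), value_succ_right _ _ (t - c) (2 * c),
        ← left, ← middle, ← right,
        IterativeArray.state_succ_of_ne_one _ _ _ (by omega) (by omega)]
      simp only [Nat.cast_succ, add_sub_cancel_right]
      rfl

theorem language_toIterativeArray : G.toIterativeArray.realTimeLanguage = G.language := by
  ext w
  have final : (G.toIterativeArray.state w w.length 1).join = G.value w w.length 0 :=
    G.join_state_toIterativeArray (c := 0) le_rfl
  constructor
  · rintro ⟨-, q, hq, hstate⟩
    exact ⟨q, hq, final.symm.trans hstate⟩
  · rintro ⟨q, hq, hval⟩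
    refine ⟨?_, q, hq, final.trans hval⟩
    rintro rfl
    simp [value_zero_left] at hval

end DiagonalGrid

theorem realTimeIA_eq_diagonalGridLanguages (A : Type*) :
    RealTimeIA A = DiagonalGridLanguages A := by
  refine Set.Subset.antisymm ?_ ?_
  · rintro _ ⟨M, rfl⟩
    exact ⟨M.toGrid, M.language_toGrid.symm⟩
  · rintro _ ⟨G, rfl⟩
    exact ⟨G.toIterativeArray, G.language_toIterativeArray.symm⟩

/-! ### Satisfaction of formulas -/

theorem WordStructure.val_sub {A : Type*} (w : List A) (i : Fin w.length) (a : ℕ) :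
    (WordStructure.sub w i a : ℕ) = i - a := by
  induction a with
  | zero => rfl
  | succ a ih =>
    rw [WordStructure.sub, Function.iterate_succ_apply', ← WordStructure.sub, ← Nat.sub_sub, ← ih]
    rfl

section SatisfactionOnNat

variable {A : Type*} {P : Type} (w : List A) (last : Option ℕ)

/-- The truth of `U` at the point `z` of the half-line `ℕ`, where `last` is the last position, or
`none` if no position counts as the last one. -/
def Extremum.HoldsAt (z : ℕ) : Extremum → Prop
  | .min => z = 0
  | .max => last = some z

/-- The truth of a hypothesis at the point `(i, j)` of the quarter-plane `ℕ × ℕ`, where the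
predecessor of `i` is `i - 1` in truncated subtraction. -/
def DioHyp.HoldsAt (R : P → ℕ → ℕ → Prop) (i j : ℕ) : DioHyp A P → Prop
  | .letter s a => w[i - a]? = some s ∧ i = j
  | .pos U v a => U.HoldsAt last (v.value i j - a)
  | .neg U v a => ¬ U.HoldsAt last (v.value i j - a)
  | .comp S a b => R S (i - a) (j - b)
  | .compSwap S b a => R S (j - b) (i - a)

/-- The predicate of a conclusion, `none` standing for `⊥`. -/
def DioConclusion.pred : DioConclusion P → Option P
  | .atom R => some R
  | .falsum => none

/-- The truth of a clause at the point `(i, j)` of `ℕ × ℕ`. -/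
def DioClause.HoldsAt (R : P → ℕ → ℕ → Prop) (i j : ℕ) (C : DioClause A P) : Prop :=
  (∀ φ ∈ C.hyps, φ.HoldsAt w last R i j) → ∃ p ∈ C.concl.pred, R p i j

variable {w last}

theorem DioClause.holdsAt_atom_iff {R : P → ℕ → ℕ → Prop} {i j : ℕ} {hyps : List (DioHyp A P)}
    {p : P} : (⟨hyps, .atom p⟩ : DioClause A P).HoldsAt w last R i j ↔
      ((∀ φ ∈ hyps, φ.HoldsAt w last R i j) → R p i j) := by
  simp [HoldsAt, DioConclusion.pred]

theorem DioClause.holdsAt_falsum_iff {R : P → ℕ → ℕ → Prop} {i j : ℕ}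
    {hyps : List (DioHyp A P)} : (⟨hyps, .falsum⟩ : DioClause A P).HoldsAt w last R i j ↔
      ¬ ∀ φ ∈ hyps, φ.HoldsAt w last R i j := by
  simp [HoldsAt, DioConclusion.pred]

theorem DioHyp.HoldsAt.imp {R R' : P → ℕ → ℕ → Prop} {i j : ℕ}
    (h : ∀ p, ∀ i' ≤ max i j, ∀ j' ≤ max i j, R p i' j' → R' p i' j') {φ : DioHyp A P}
    (hφ : φ.HoldsAt w last R i j) : φ.HoldsAt w last R' i j := by
  cases φ with
  | letter s a => exact hφ
  | pos U v a => exact hφ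
  | neg U v a => exact hφ
  | comp S a b => exact h S _ (by omega) _ (by omega) hφ
  | compSwap S b a => exact h S _ (by omega) _ (by omega) hφ

theorem Extremum.holds_sub_iff_holdsAt (U : Extremum) (i : Fin w.length) (a : ℕ) :
    U.Holds w (WordStructure.sub w i a) ↔ U.HoldsAt (some (w.length - 1)) (i - a) := by
  have hi := i.isLt
  cases U with
  | min => simp only [Holds, HoldsAt, WordStructure.IsMin, WordStructure.val_sub]
  | max =>
    simp only [Holds, HoldsAt, WordStructure.IsMax, WordStructure.val_sub, Option.some_inj]
    omega

theorem DioHyp.holds_iff_holdsAt {R : P → Fin w.length → Fin w.length → Prop}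
    {R' : P → ℕ → ℕ → Prop} (hR : ∀ p (i j : Fin w.length), R p i j ↔ R' p i j)
    (i j : Fin w.length) (φ : DioHyp A P) :
    φ.Holds w R i j ↔ φ.HoldsAt w (some (w.length - 1)) R' i j := by
  cases φ with
  | letter s a =>
    have hi : (i : ℕ) - a < w.length := lt_of_le_of_lt (Nat.sub_le _ _) i.isLt
    simp only [Holds, HoldsAt, WordStructure.Letter, List.get_eq_getElem, WordStructure.val_sub,
      List.getElem?_eq_getElem hi, Option.some_inj, Fin.ext_iff]
  | pos U v a => cases v <;> exact U.holds_sub_iff_holdsAt _ a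
  | neg U v a => cases v <;> exact not_congr (U.holds_sub_iff_holdsAt _ a)
  | comp S a b => simp only [Holds, HoldsAt, hR, WordStructure.val_sub]
  | compSwap S b a => simp only [Holds, HoldsAt, hR, WordStructure.val_sub]

theorem DioConclusion.holds_iff {R : P → Fin w.length → Fin w.length → Prop} {i j : Fin w.length}
    (c : DioConclusion P) : c.Holds w R i j ↔ ∃ p ∈ c.pred, R p i j := by
  cases c <;> simp [Holds, pred]

theorem DioFormula.satisfied_iff_exists_nat {Φ : DioFormula A} :
    Φ.Satisfied w ↔ ∃ R : Φ.Pred → ℕ → ℕ → Prop, ∀ C ∈ Φ.clauses,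
      ∀ i < w.length, ∀ j < w.length, C.HoldsAt w (some (w.length - 1)) R i j := by
  constructor
  · rintro ⟨R, hR⟩
    refine ⟨fun p i j => ∃ hi hj, R p ⟨i, hi⟩ ⟨j, hj⟩, fun C hC i hi j hj hyps => ?_⟩
    have holds : C.concl.Holds w R ⟨i, hi⟩ ⟨j, hj⟩ := hR _ _ C hC fun φ hφ =>
      (φ.holds_iff_holdsAt (fun p i j => by simp) _ _).2 (hyps φ hφ)
    simpa [hi, hj, DioConclusion.holds_iff] using holds
  · rintro ⟨R, hR⟩
    refine ⟨fun p i j => R p i j, fun i j C hC hyps => C.concl.holds_iff.2 ?_⟩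
    exact hR C hC i i.isLt j j.isLt fun φ hφ =>
      (φ.holds_iff_holdsAt (fun p i j => Iff.rfl) i j).1 (hyps φ hφ)

end SatisfactionOnNat

/-! ### From grids to formulas -/

namespace DiagonalGrid

variable {A : Type*} (G : DiagonalGrid A)

/-- The hypotheses stating that `l` is the value of `G` at the left neighbor of `(x, y)`. -/
def leftHyps : Option G.State → List (DioHyp A G.State)
  | none => [.pos .min .x 0]
  | some q => [.neg .min .x 0, .comp q 1 0]

/-- The clause computing the value on the diagonal from the letter `a` and the value `l` at the left
neighbor. -/
def inputClause (a : A) (l : Option G.State) : DioClause A G.State :=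
  ⟨.letter a 0 :: G.leftHyps l, .atom (G.diag a l)⟩

/-- The clause computing the value off the diagonal from the value `q` at the predecessor in `y` and
the value `l` at the left neighbor. -/
def innerClause (q : G.State) (l : Option G.State) : DioClause A G.State :=
  ⟨.neg .min .y 0 :: .comp q 0 1 :: G.leftHyps l, .atom (G.inner l q)⟩

/-- The clause forbidding the value `q` at the last point. -/
def rejectClause (q : G.State) : DioClause A G.State :=
  ⟨[.pos .max .x 0, .pos .max .y 0, .comp q 0 0], .falsum⟩

/-- The clauses of the formula defining the language of `G`. -/
def clauses : Set (DioClause A G.State) :=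
  Set.range (Function.uncurry G.inputClause) ∪ Set.range (Function.uncurry G.innerClause) ∪
    G.rejectClause '' G.acceptᶜ

theorem finite_clauses [Finite A] : G.clauses.Finite :=
  have := G.finite_state
  ((Set.finite_range _).union (Set.finite_range _)).union ((Set.toFinite _).image _)

/-- The formula defining the language of `G`, with a predicate for each state. -/
noncomputable def toFormula [Finite A] : DioFormula A where
  Pred := G.State
  finite_pred := G.finite_state
  clauses := G.finite_clauses.toFinset.toList

theorem mem_clauses_toFormula [Finite A] {C : DioClause A G.State} :
    C ∈ G.toFormula.clauses ↔ C ∈ G.clauses :=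
  Finset.mem_toList.trans (Set.Finite.mem_toFinset _)

theorem forall_mem_clauses_iff {p : DioClause A G.State → Prop} :
    (∀ C ∈ G.clauses, p C) ↔ (∀ a l, p (G.inputClause a l)) ∧
      (∀ q l, p (G.innerClause q l)) ∧ ∀ q ∉ G.accept, p (G.rejectClause q) := by
  simp only [clauses, Set.mem_union, or_imp, forall_and, Set.forall_mem_range,
    Set.forall_mem_image, Prod.forall, Function.uncurry_apply_pair, Set.mem_compl_iff, and_assoc]

variable {G} {w : List A} {last : Option ℕ}

theorem forall_leftHyps_holdsAt_iff {R : G.State → ℕ → ℕ → Prop} {i j : ℕ} {l : Option G.State} :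
    (∀ φ ∈ G.leftHyps l, φ.HoldsAt w last R i j) ↔
      l.elim (i = 0) fun q => i ≠ 0 ∧ R q (i - 1) j := by
  cases l <;> simp [leftHyps, DioHyp.HoldsAt, Extremum.HoldsAt, HornVar.value]

/-- The intended interpretation of the predicates of `G.toFormula`. Positions are counted from `0`
in formulas and from `1` in grids. -/
def ValueAt (G : DiagonalGrid A) (w : List A) (q : G.State) (i j : ℕ) : Prop :=
  ∃ d, j = i + d ∧ G.value w (i + 1) d = some q

theorem value_eq_of_leftHyps {l : Option G.State} {i d : ℕ}
    (h : ∀ φ ∈ G.leftHyps l, φ.HoldsAt w last (G.ValueAt w) i (i + d)) :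
    G.value w i (d + 1) = l := by
  rw [forall_leftHyps_holdsAt_iff] at h
  cases l with
  | none => exact (show i = 0 from h) ▸ G.value_zero_left w _
  | some q =>
    obtain ⟨hi, e, he, hq⟩ := h
    obtain rfl : e = d + 1 := by omega
    rwa [Nat.sub_one_add_one hi] at hq

theorem inputClause_holdsAt_valueAt (a : A) (l : Option G.State) (i j : ℕ) :
    (G.inputClause a l).HoldsAt w last (G.ValueAt w) i j := by
  refine DioClause.holdsAt_atom_iff.2 fun h => ?_
  obtain ⟨⟨ha, rfl⟩, hl⟩ := List.forall_mem_cons.1 h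
  refine ⟨0, rfl, ?_⟩
  rw [value, show w[i]? = some a from ha, value_eq_of_leftHyps (d := 0) hl, Option.map_some]

theorem innerClause_holdsAt_valueAt (q : G.State) (l : Option G.State) (i j : ℕ) :
    (G.innerClause q l).HoldsAt w last (G.ValueAt w) i j := by
  refine DioClause.holdsAt_atom_iff.2 fun h => ?_
  obtain ⟨hj, ⟨d, hd, hq⟩, hl⟩ := by simpa only [List.forall_mem_cons] using h
  replace hj : j ≠ 0 := hj
  obtain rfl : j = i + (d + 1) := by omega
  refine ⟨d + 1, rfl, ?_⟩
  rw [value, value_eq_of_leftHyps hl, show G.value w (i + 1) d = some q from hq]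
  rfl

theorem rejectClause_holdsAt_iff {R : G.State → ℕ → ℕ → Prop} {q : G.State} {n : ℕ} :
    (∀ i < n + 1, ∀ j < n + 1, (G.rejectClause q).HoldsAt w (some n) R i j) ↔ ¬ R q n n := by
  simp only [rejectClause, DioClause.holdsAt_falsum_iff, List.forall_mem_cons, DioHyp.HoldsAt,
    Extremum.HoldsAt, HornVar.value]
  constructor
  · exact fun h hR => h n n.lt_succ_self n n.lt_succ_self ⟨rfl, rfl, hR, List.forall_mem_nil _⟩
  · rintro h i - j - ⟨⟨rfl⟩, ⟨rfl⟩, hR, -⟩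
    exact h hR

theorem holds_of_value_eq {R : G.State → ℕ → ℕ → Prop}
    (input : ∀ a l, ∀ i < w.length, ∀ j < w.length, (G.inputClause a l).HoldsAt w last R i j)
    (inner : ∀ q l, ∀ i < w.length, ∀ j < w.length, (G.innerClause q l).HoldsAt w last R i j)
    {q : G.State} {i d : ℕ} (hid : i + d < w.length) (hq : G.value w (i + 1) d = some q) :
    R q i (i + d) := by
  induction i using Nat.strong_induction_on generalizing d q with
  | h i ih =>
    have left (d : ℕ) (hid : i + d < w.length) :
        ∀ φ ∈ G.leftHyps (G.value w i (d + 1)), φ.HoldsAt w last R i (i + d) := by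
      rw [forall_leftHyps_holdsAt_iff]
      cases i with
      | zero => rw [value_zero_left]; rfl
      | succ i =>
        obtain ⟨q, hq⟩ := Option.isSome_iff_exists.1 (G.isSome_value (w := w) (x := i) (by omega) _)
        rw [hq]
        have := ih i i.lt_succ_self (by omega) hq
        exact ⟨i.succ_ne_zero, by rwa [Nat.add_sub_cancel, Nat.add_right_comm]⟩
    induction d generalizing q with
    | zero =>
      obtain rfl := Option.some_injective _ ((G.value_succ_zero hid).symm.trans hq)
      exact DioClause.holdsAt_atom_iff.1 (input _ _ i hid i hid)
        (List.forall_mem_cons.2 ⟨⟨List.getElem?_eq_getElem hid, rfl⟩, left 0 hid⟩)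
    | succ d ihd =>
      rw [value_succ_right] at hq
      obtain ⟨below, hbelow, rfl⟩ := Option.map_eq_some_iff.1 hq
      exact DioClause.holdsAt_atom_iff.1 (inner below _ i (by omega) _ hid) (List.forall_mem_cons.2
        ⟨(i + d).succ_ne_zero, List.forall_mem_cons.2 ⟨ihd (by omega) hbelow, left _ hid⟩⟩)

theorem satisfied_toFormula_iff [Finite A] {n : ℕ} (hn : w.length = n + 1) :
    G.toFormula.Satisfied w ↔ ∃ R : G.State → ℕ → ℕ → Prop,
      (∀ a l, ∀ i < n + 1, ∀ j < n + 1, (G.inputClause a l).HoldsAt w (some n) R i j) ∧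
      (∀ q l, ∀ i < n + 1, ∀ j < n + 1, (G.innerClause q l).HoldsAt w (some n) R i j) ∧
      ∀ q ∉ G.accept, ¬ R q n n := by
  refine DioFormula.satisfied_iff_exists_nat.trans (exists_congr fun R => ?_)
  refine (forall_congr' fun C => imp_congr_left G.mem_clauses_toFormula).trans ?_
  rw [hn]
  refine G.forall_mem_clauses_iff.trans (and_congr_right' (and_congr_right' ?_))
  exact forall₂_congr fun q _ => rejectClause_holdsAt_iff

theorem language_toFormula [Finite A] : G.toFormula.language = G.language := by
  ext w
  obtain rfl | hw := eq_or_ne w []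
  · refine iff_of_false (fun h => h.1 rfl) ?_
    rintro ⟨q, -, hq⟩
    simp [value_zero_left] at hq
  obtain ⟨n, hn⟩ := Nat.exists_eq_add_one.2 (List.length_pos_iff.2 hw)
  refine (and_iff_right hw).trans ((satisfied_toFormula_iff hn).trans ?_)
  constructor
  · rintro ⟨R, input, inner, reject⟩
    obtain ⟨q, hq⟩ := Option.isSome_iff_exists.1 (G.isSome_value (w := w) (x := n) (by omega) 0)
    have last : R q n n := holds_of_value_eq (d := 0) (hn ▸ input) (hn ▸ inner) (by omega) hq
    exact ⟨q, not_imp_not.1 (reject q) last, hn ▸ hq⟩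
  · rintro ⟨q, hq, hval⟩
    refine ⟨G.ValueAt w, fun a l i _ j _ => inputClause_holdsAt_valueAt a l i j,
      fun q l i _ j _ => innerClause_holdsAt_valueAt q l i j, ?_⟩
    rintro p hp ⟨d, hd, hpval⟩
    obtain rfl : d = 0 := by omega
    obtain rfl : p = q := Option.some_injective _ (hpval.symm.trans (hn ▸ hval))
    exact hp hq

end DiagonalGrid

/-! ### Derivations -/

/-- The largest number subtracted in a hypothesis. -/
def DioHyp.depth {A : Type*} {P : Type} : DioHyp A P → ℕ
  | .letter _ a => a
  | .pos _ _ a => a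
  | .neg _ _ a => a
  | .comp _ a b => max a b
  | .compSwap _ b a => max a b

namespace DioFormula

variable {A : Type*}

theorem exists_depth_le (Φ : DioFormula A) :
    ∃ K, 1 ≤ K ∧ ∀ C ∈ Φ.clauses, ∀ φ ∈ C.hyps, φ.depth ≤ K := by
  obtain ⟨K, hK⟩ := ((Φ.clauses.flatMap DioClause.hyps).map DioHyp.depth).finite_toSet.bddAbove
  exact ⟨K + 1, by omega, fun C hC φ hφ =>
    (hK (List.mem_map_of_mem (List.mem_flatMap.2 ⟨C, hC, hφ⟩))).trans K.le_succ⟩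

/-- The atoms derivable with the clauses of `Φ` in the quarter-plane, `none` standing for `⊥`. A
derived `⊥` propagates to the neighboring points, so that it can be observed at the last point. -/
inductive Derives (Φ : DioFormula A) (w : List A) (last : Option ℕ) :
    Option Φ.Pred → ℕ → ℕ → Prop
  | clause {C : DioClause A Φ.Pred} (hC : C ∈ Φ.clauses) {R : Φ.Pred → ℕ → ℕ → Prop}
      (hR : ∀ p i j, R p i j → Derives Φ w last (some p) i j) {i j : ℕ}
      (h : ∀ φ ∈ C.hyps, φ.HoldsAt w last R i j) : Derives Φ w last C.concl.pred i j
  | falsum_left {i j : ℕ} : Derives Φ w last none i j → Derives Φ w last none (i + 1) j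
  | falsum_right {i j : ℕ} : Derives Φ w last none i j → Derives Φ w last none i (j + 1)

variable {Φ : DioFormula A} {w : List A} {last : Option ℕ}

theorem Derives.falsum_mono {i j i' j' : ℕ} (h : Φ.Derives w last none i j) (hi : i ≤ i')
    (hj : j ≤ j') : Φ.Derives w last none i' j' := by
  induction hi with
  | refl =>
    induction hj with
    | refl => exact h
    | step _ ih => exact ih.falsum_right
  | step _ ih => exact ih.falsum_left

theorem Derives.exists_of_model {n : ℕ} {R : Φ.Pred → ℕ → ℕ → Prop}
    (hR : ∀ C ∈ Φ.clauses, ∀ i < n, ∀ j < n, C.HoldsAt w last R i j) {p : Option Φ.Pred}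
    {i j : ℕ} (hi : i < n) (hj : j < n) (h : Φ.Derives w last p i j) : ∃ q ∈ p, R q i j := by
  induction h with
  | clause hC _ hyps ih =>
    refine hR _ hC _ hi _ hj fun φ hφ => (hyps φ hφ).imp fun q i' hi' j' hj' hq => ?_
    simpa using ih q i' j' hq (by omega) (by omega)
  | falsum_left _ ih => simpa using ih (by omega) hj
  | falsum_right _ ih => simpa using ih hi (by omega)

theorem satisfied_iff_not_derives {n : ℕ} (hn : w.length = n + 1) :
    Φ.Satisfied w ↔ ¬ Φ.Derives w (some n) none n n := by
  rw [satisfied_iff_exists_nat, hn, Nat.add_sub_cancel]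
  constructor
  · rintro ⟨R, hR⟩ h
    simpa using h.exists_of_model hR n.lt_succ_self n.lt_succ_self
  · intro h
    refine ⟨fun p => Φ.Derives w (some n) (some p), fun C hC i hi j hj hyps => ?_⟩
    have derived := Derives.clause hC (fun _ _ _ => id) hyps
    cases hp : C.concl.pred with
    | some p => exact ⟨p, rfl, by rwa [hp] at derived⟩
    | none =>
      rw [hp] at derived
      exact (h (derived.falsum_mono (by omega) (by omega))).elim

variable (Φ w last) in
/-- The predicates derivable at `(i, j)` and those derivable at `(j, i)`. -/
def cell (i j : ℕ) : Set (Option Φ.Pred) × Set (Option Φ.Pred) :=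
  ({p | Φ.Derives w last p i j}, {p | Φ.Derives w last p j i})

variable (Φ) in
/-- The points `(x, y)` for the word `w` and `(x', y')` for the word `w'` have the same
neighborhoods up to the distance `K`, apart from the predicates derivable at the points
themselves. -/
structure AgreeBefore (K : ℕ) (w : List A) (last : Option ℕ) (x y : ℕ)
    (w' : List A) (last' : Option ℕ) (x' y' : ℕ) : Prop where
  diag : x = y ↔ x' = y'
  letter : ∀ a ≤ K, x = y → w[x - a]? = w'[x' - a]?
  extremum : ∀ (U : Extremum) (v : HornVar), ∀ a ≤ K,
    U.HoldsAt last (v.value x y - a) ↔ U.HoldsAt last' (v.value x' y' - a)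
  cell : ∀ a ≤ K, ∀ b ≤ K, (x - a, y - b) ≠ (x, y) →
    Φ.cell w last (x - a) (y - b) = Φ.cell w' last' (x' - a) (y' - b)

namespace AgreeBefore

variable {K x y x' y' : ℕ} {w' : List A} {last' : Option ℕ}

theorem symm (h : Φ.AgreeBefore K w last x y w' last' x' y') :
    Φ.AgreeBefore K w' last' x' y' w last x y where
  diag := h.diag.symm
  letter a ha e := (h.letter a ha (h.diag.2 e)).symm
  extremum U v a ha := (h.extremum U v a ha).symm
  cell a ha b hb hab := by
    have hx := h.extremum .min .x 0 K.zero_le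
    have hy := h.extremum .min .y 0 K.zero_le
    simp only [Extremum.HoldsAt, HornVar.value] at hx hy
    refine (h.cell a ha b hb fun e => hab ?_).symm
    simp only [Prod.mk.injEq] at e ⊢
    omega

theorem swap (h : Φ.AgreeBefore K w last x y w' last' x' y') :
    Φ.AgreeBefore K w last y x w' last' y' x' where
  diag := eq_comm.trans (h.diag.trans eq_comm)
  letter a ha e := by
    have := h.letter a ha e.symm
    rwa [h.diag.1 e.symm, ← e] at this
  extremum
    | U, .x => h.extremum U .y
    | U, .y => h.extremum U .x
  cell a ha b hb hab :=
    congrArg Prod.swap (h.cell b hb a ha fun e => hab (congrArg Prod.swap e))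

theorem imp_of_imp_at_point (h : Φ.AgreeBefore K w last x y w' last' x' y') {p : Option Φ.Pred}
    {R : ℕ → ℕ → Prop} (hR : ∀ i j, R i j → Φ.Derives w last p i j)
    (hp : R x y → Φ.Derives w' last' p x' y') {a b : ℕ} (ha : a ≤ K) (hb : b ≤ K)
    (hab : R (x - a) (y - b)) : Φ.Derives w' last' p (x' - a) (y' - b) := by
  by_cases e : (x - a, y - b) = (x, y)
  · have hx := h.extremum .min .x 0 K.zero_le
    have hy := h.extremum .min .y 0 K.zero_le
    simp only [Extremum.HoldsAt, HornVar.value, Nat.sub_zero, Prod.mk.injEq] at hx hy e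
    rw [show x' - a = x' by omega, show y' - b = y' by omega]
    rw [e.1, e.2] at hab
    exact hp hab
  · have h_cell := congrArg Prod.fst (h.cell a ha b hb e)
    exact (Set.ext_iff.1 h_cell p).1 (hR _ _ hab)

theorem holdsAt (h : Φ.AgreeBefore K w last x y w' last' x' y') {R : Φ.Pred → ℕ → ℕ → Prop}
    (hR : ∀ p i j, R p i j → Φ.Derives w last (some p) i j)
    (point : ∀ p, R p x y → Φ.Derives w' last' (some p) x' y')
    (swapped : ∀ p, R p y x → Φ.Derives w' last' (some p) y' x') {φ : DioHyp A Φ.Pred}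
    (hdepth : φ.depth ≤ K) (hφ : φ.HoldsAt w last R x y) :
    φ.HoldsAt w' last' (fun p => Φ.Derives w' last' (some p)) x' y' := by
  cases φ with
  | letter s a => exact ⟨h.letter a hdepth hφ.2 ▸ hφ.1, h.diag.1 hφ.2⟩
  | pos U v a => exact (h.extremum U v a hdepth).1 hφ
  | neg U v a => exact (h.extremum U v a hdepth).not.1 hφ
  | comp S a b =>
    obtain ⟨ha, hb⟩ := max_le_iff.1 hdepth
    exact h.imp_of_imp_at_point (hR S) (point S) ha hb hφ
  | compSwap S b a =>
    obtain ⟨ha, hb⟩ := max_le_iff.1 hdepth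
    exact h.swap.imp_of_imp_at_point (hR S) (swapped S) (by omega) (by omega) hφ

theorem derives (h : Φ.AgreeBefore K w last x y w' last' x' y') (hK : 1 ≤ K)
    (hdepth : ∀ C ∈ Φ.clauses, ∀ φ ∈ C.hyps, φ.depth ≤ K) {p : Option Φ.Pred}
    (hp : Φ.Derives w last p x y) : Φ.Derives w' last' p x' y' := by
  induction hp generalizing x' y' with
  | clause hC hR hyps ih =>
    exact .clause hC (fun _ _ _ => id) fun φ hφ => h.holdsAt hR (fun p hp => ih p _ _ hp h)
      (fun p hp => ih p _ _ hp h.swap) (hdepth _ hC φ hφ) (hyps φ hφ)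
  | falsum_left hp =>
    have h_cell := congrArg Prod.fst (h.cell 1 hK 0 K.zero_le (by simp))
    exact ((Set.ext_iff.1 h_cell none).1 hp).falsum_mono (Nat.sub_le _ _) (Nat.sub_le _ _)
  | falsum_right hp =>
    have h_cell := congrArg Prod.fst (h.cell 0 K.zero_le 1 hK (by simp))
    exact ((Set.ext_iff.1 h_cell none).1 hp).falsum_mono (Nat.sub_le _ _) (Nat.sub_le _ _)

theorem cell_eq (h : Φ.AgreeBefore K w last x y w' last' x' y') (hK : 1 ≤ K)
    (hdepth : ∀ C ∈ Φ.clauses, ∀ φ ∈ C.hyps, φ.depth ≤ K) :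
    Φ.cell w last x y = Φ.cell w' last' x' y' := by
  refine Prod.ext (Set.ext fun p => ?_) (Set.ext fun p => ?_)
  · exact ⟨h.derives hK hdepth, h.symm.derives hK hdepth⟩
  · exact ⟨h.swap.derives hK hdepth, h.swap.symm.derives hK hdepth⟩

end AgreeBefore

theorem cell_eq_of_last_ne {last' : Option ℕ} (i j : ℕ) (h : ∀ z ≤ max i j, last ≠ some z)
    (h' : ∀ z ≤ max i j, last' ≠ some z) : Φ.cell w last i j = Φ.cell w last' i j := by
  obtain ⟨K, hK, hdepth⟩ := Φ.exists_depth_le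
  refine AgreeBefore.cell_eq (K := K) ⟨Iff.rfl, fun _ _ _ => rfl, fun U v a _ => ?_,
    fun a _ b _ hab => ?_⟩ hK hdepth
  · cases U with
    | min => rfl
    | max =>
      have hz : v.value i j - a ≤ max i j := by
        cases v <;> simp only [HornVar.value] <;> omega
      exact iff_of_false (h _ hz) (h' _ hz)
  · have : i - a + (j - b) < i + j := by
      simp only [ne_eq, Prod.mk.injEq] at hab
      omega
    exact cell_eq_of_last_ne _ _ (fun z hz => h z (by omega)) fun z hz => h' z (by omega)
termination_by i + j

/-! ### Windows -/

variable (Φ) in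
/-- The information carried by the state of a grid at a point `(x, y)`: the coordinates up to
`K + 1`, the letters at `x - a` for `a ≤ K`, and the cells at `(x - a, y - b)` for `a, b ≤ K`, both
with the last position `y` (flag `true`) and without a last position (flag `false`). -/
abbrev Window (K : ℕ) : Type _ :=
  Fin (K + 2) × Fin (K + 2) × (Fin (K + 1) → Option A) ×
    (Bool → Fin (K + 1) → Fin (K + 1) → Set (Option Φ.Pred) × Set (Option Φ.Pred))

/-- The last position `y`, if the flag says that there is one. -/
def lastInRow (isLast : Bool) (y : ℕ) : Option ℕ := if isLast then some y else none

theorem lastInRow_ne {l : Bool} {y z : ℕ} (h : z < y) : lastInRow l y ≠ some z := by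
  cases l <;> simp [lastInRow, h.ne']

variable (Φ) in
/-- The window of the word `w` at the point `(x, y)`. -/
def window (K : ℕ) (w : List A) (x y : ℕ) : Φ.Window K :=
  (⟨min x (K + 1), by omega⟩, ⟨min y (K + 1), by omega⟩, fun a => w[x - a]?,
    fun l a b => Φ.cell w (lastInRow l y) (x - a) (y - b))

variable (Φ) in
/-- Equality of windows, unfolded. -/
structure SameWindow (K : ℕ) (w : List A) (x y : ℕ) (w' : List A) (x' y' : ℕ) : Prop where
  left : min x (K + 1) = min x' (K + 1)
  right : min y (K + 1) = min y' (K + 1)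
  letter : ∀ a ≤ K, w[x - a]? = w'[x' - a]?
  cell : ∀ l, ∀ a ≤ K, ∀ b ≤ K,
    Φ.cell w (lastInRow l y) (x - a) (y - b) = Φ.cell w' (lastInRow l y') (x' - a) (y' - b)

theorem window_eq_iff {K x y x' y' : ℕ} {w' : List A} :
    Φ.window K w x y = Φ.window K w' x' y' ↔ Φ.SameWindow K w x y w' x' y' := by
  simp only [window, Prod.mk.injEq, Fin.mk.injEq, funext_iff]
  constructor
  · rintro ⟨left, right, letter, cell⟩
    exact ⟨left, right, fun a ha => letter ⟨a, Nat.lt_succ_of_le ha⟩, fun l a ha b hb =>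
      cell l ⟨a, Nat.lt_succ_of_le ha⟩ ⟨b, Nat.lt_succ_of_le hb⟩⟩
  · intro h
    exact ⟨h.left, h.right, fun a => h.letter a a.is_le,
      fun l a b => h.cell l a a.is_le b b.is_le⟩

namespace SameWindow

variable {K x y x' y' : ℕ} {w' : List A}

theorem of_preceding (hK : 1 ≤ K) (hdepth : ∀ C ∈ Φ.clauses, ∀ φ ∈ C.hyps, φ.depth ≤ K)
    (hxy : x ≤ y) (hxy' : x' ≤ y') (diag : x = y ↔ x' = y')
    (left : min x (K + 1) = min x' (K + 1)) (right : min y (K + 1) = min y' (K + 1))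
    (letter : ∀ a ≤ K, w[x - a]? = w'[x' - a]?)
    (cell : ∀ l, ∀ a ≤ K, ∀ b ≤ K, (x - a, y - b) ≠ (x, y) →
      Φ.cell w (lastInRow l y) (x - a) (y - b) = Φ.cell w' (lastInRow l y') (x' - a) (y' - b)) :
    Φ.SameWindow K w x y w' x' y' := by
  refine ⟨left, right, letter, fun l a ha b hb => ?_⟩
  by_cases hab : (x - a, y - b) = (x, y)
  · have agree : Φ.AgreeBefore K w (lastInRow l y) x y w' (lastInRow l y') x' y' := by
      refine ⟨diag, fun a ha _ => letter a ha, fun U v a ha => ?_, cell l⟩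
      cases U <;> cases v <;> cases l <;>
        simp only [Extremum.HoldsAt, HornVar.value, lastInRow, if_true, if_false,
          Option.some_inj, Bool.false_eq_true, reduceCtorEq] <;> omega
    simp only [Prod.mk.injEq] at hab
    rw [hab.1, hab.2, show x' - a = x' by omega, show y' - b = y' by omega]
    exact agree.cell_eq hK hdepth
  · exact cell l a ha b hb hab

theorem inner (hK : 1 ≤ K) (hdepth : ∀ C ∈ Φ.clauses, ∀ φ ∈ C.hyps, φ.depth ≤ K)
    (hxy : x ≤ y) (hxy' : x' ≤ y')
    (h_left : x ≠ 0 → Φ.SameWindow K w (x - 1) (y + 1) w' (x' - 1) (y' + 1))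
    (h_below : Φ.SameWindow K w x y w' x' y') :
    Φ.SameWindow K w x (y + 1) w' x' (y' + 1) := by
  have left := h_below.left
  have right := h_below.right
  refine of_preceding hK hdepth (by omega) (by omega) (by omega) left (by omega) h_below.letter
    fun l a ha b hb hab => ?_
  simp only [ne_eq, Prod.mk.injEq] at hab
  by_cases hxa : x - a = x
  · rw [show y + 1 - b = y - (b - 1) by omega, show y' + 1 - b = y' - (b - 1) by omega,
      cell_eq_of_last_ne (last' := none) _ _ (fun z hz => lastInRow_ne (by omega)) (by simp),
      cell_eq_of_last_ne (last' := none) (x' - a) _ (fun z hz => lastInRow_ne (by omega))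
        (by simp)]
    exact h_below.cell false a ha (b - 1) (by omega)
  · rw [show x - a = x - 1 - (a - 1) by omega, show x' - a = x' - 1 - (a - 1) by omega]
    exact (h_left (by omega)).cell l (a - 1) (by omega) b hb

theorem diagonal (hK : 1 ≤ K) (hdepth : ∀ C ∈ Φ.clauses, ∀ φ ∈ C.hyps, φ.depth ≤ K)
    (hx : x = 0 ↔ x' = 0) (h_left : x ≠ 0 → Φ.SameWindow K w (x - 1) x w' (x' - 1) x')
    (h_letter : w[x]? = w'[x']?) : Φ.SameWindow K w x x w' x' x' := by
  have left : min x (K + 1) = min x' (K + 1) := by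
    by_cases h : x = 0
    · rw [h, hx.1 h]
    · exact (h_left h).right
  refine of_preceding hK hdepth le_rfl le_rfl (by simp) left left (fun a ha => ?_)
    fun l a ha b hb hab => ?_
  · by_cases hxa : x - a = x
    · rwa [hxa, show x' - a = x' by omega]
    · rw [show x - a = x - 1 - (a - 1) by omega, show x' - a = x' - 1 - (a - 1) by omega]
      exact (h_left (by omega)).letter (a - 1) (by omega)
  · simp only [ne_eq, Prod.mk.injEq] at hab
    by_cases hxa : x - a = x
    · have := (h_left (by omega)).cell l (b - 1) (by omega) a ha
      rw [show x - b = x - 1 - (b - 1) by omega, show x' - b = x' - 1 - (b - 1) by omega]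
      exact congrArg Prod.swap this
    · rw [show x - a = x - 1 - (a - 1) by omega, show x' - a = x' - 1 - (a - 1) by omega]
      exact (h_left (by omega)).cell l (a - 1) (by omega) b hb

end SameWindow

end DioFormula

/-! ### From formulas to grids -/

/-- The value of `h` at the left neighbor of the column `x`, if there is one. -/
def leftValue {Γ : Type*} (h : ℕ → ℕ → Γ) : ℕ → ℕ → Option Γ
  | 0, _ => none
  | x + 1, d => some (h x d)

namespace DiagonalGrid

variable {A : Type*} {G : DiagonalGrid A} {w : List A} {h : ℕ → ℕ → G.State}

theorem value_eq_leftValue (inner : ∀ x d, h x (d + 1) = G.inner (leftValue h x (d + 2)) (h x d))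
    (diag : ∀ x (hx : x < w.length), h x 0 = G.diag w[x] (leftValue h x 1)) {x : ℕ}
    (hx : x ≤ w.length) (d : ℕ) : G.value w x d = leftValue h x d := by
  induction x generalizing d with
  | zero => exact G.value_zero_left w d
  | succ x ihx =>
    induction d with
    | zero => rw [G.value_succ_zero hx, ihx (by omega), leftValue, diag x hx]
    | succ d ihd =>
      rw [G.value_succ_right, ihd, Nat.add_sub_cancel, ihx (by omega), leftValue, leftValue, inner]
      rfl

theorem mem_language_iff_of_recursion
    (inner : ∀ x d, h x (d + 1) = G.inner (leftValue h x (d + 2)) (h x d))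
    (diag : ∀ x (hx : x < w.length), h x 0 = G.diag w[x] (leftValue h x 1)) :
    w ∈ G.language ↔ w ≠ [] ∧ h (w.length - 1) 0 ∈ G.accept := by
  change (∃ q ∈ G.accept, G.value w w.length 0 = some q) ↔ _
  rw [value_eq_leftValue inner diag le_rfl, ← List.length_pos_iff]
  cases w.length <;> simp [leftValue]

end DiagonalGrid

theorem setOf_mem_diagonalGridLanguages_of_determined {A : Type*} {Γ : Type} [Finite Γ]
    (H : List A → ℕ → ℕ → Γ)
    (inner : ∀ {w w' x x' d d'}, leftValue (H w) x (d + 2) = leftValue (H w') x' (d' + 2) →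
      H w x d = H w' x' d' → H w x (d + 1) = H w' x' (d' + 1))
    (diag : ∀ {w w' x x'}, w[x]? = w'[x']? → leftValue (H w) x 1 = leftValue (H w') x' 1 →
      H w x 0 = H w' x' 0) (S : Set Γ) :
    {w | w ≠ [] ∧ H w (w.length - 1) 0 ∈ S} ∈ DiagonalGridLanguages A := by
  have : Nonempty Γ := ⟨H [] 0 0⟩
  obtain ⟨f, hf⟩ : ∃ f : Option Γ × Γ → Γ, ∀ w x d,
      H w x (d + 1) = f (leftValue (H w) x (d + 2), H w x d) := by
    have factors : Function.FactorsThrough (fun p : List A × ℕ × ℕ => H p.1 p.2.1 (p.2.2 + 1))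
        fun p => (leftValue (H p.1) p.2.1 (p.2.2 + 2), H p.1 p.2.1 p.2.2) :=
      fun p q h => inner (congrArg Prod.fst h) (congrArg Prod.snd h)
    obtain ⟨f, hf⟩ := (Function.factorsThrough_iff _).1 factors
    exact ⟨f, fun w x d => congrFun hf (w, x, d)⟩
  obtain ⟨g, hg⟩ : ∃ g : Option A × Option Γ → Γ, ∀ w x,
      H w x 0 = g (w[x]?, leftValue (H w) x 1) := by
    have factors : Function.FactorsThrough (fun p : List A × ℕ => H p.1 p.2 0)
        fun p => (p.1[p.2]?, leftValue (H p.1) p.2 1) :=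
      fun p q h => diag (congrArg Prod.fst h) (congrArg Prod.snd h)
    obtain ⟨g, hg⟩ := (Function.factorsThrough_iff _).1 factors
    exact ⟨g, fun w x => congrFun hg (w, x)⟩
  let G : DiagonalGrid A := ⟨Γ, ‹_›, fun l q => f (l, q), fun a l => g (some a, l), S⟩
  refine ⟨G, Set.ext fun w => Iff.symm ?_⟩
  refine G.mem_language_iff_of_recursion (h := H w) (hf w) fun x hx => ?_
  rw [hg, List.getElem?_eq_getElem hx]

theorem leftValue_eq_iff {Γ : Type*} {h h' : ℕ → ℕ → Γ} {x x' d d' : ℕ} :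
    leftValue h x d = leftValue h' x' d' ↔
      (x = 0 ↔ x' = 0) ∧ (x ≠ 0 → h (x - 1) d = h' (x' - 1) d') := by
  cases x <;> cases x' <;> simp [leftValue]

theorem DioFormula.language_mem_diagonalGridLanguages {A : Type*} [Finite A] (Φ : DioFormula A) :
    Φ.language ∈ DiagonalGridLanguages A := by
  obtain ⟨K, hK, hdepth⟩ := Φ.exists_depth_le
  have := Φ.finite_pred
  obtain ⟨m, ⟨e⟩⟩ := Finite.exists_equiv_fin (Φ.Window K)
  let H (w : List A) (x d : ℕ) := e (Φ.window K w x (x + d))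
  have H_eq_iff {w w' : List A} {x x' d d' : ℕ} :
      H w x d = H w' x' d' ↔ Φ.SameWindow K w x (x + d) w' x' (x' + d') :=
    e.injective.eq_iff.trans window_eq_iff
  have language_eq : Φ.language = {w | w ≠ [] ∧ H w (w.length - 1) 0 ∈
      {q | none ∉ ((e.symm q).2.2.2 true 0 0).1}} := by
    refine Set.ext fun w => and_congr_right fun hw => ?_
    have hn : w.length = w.length - 1 + 1 := by
      have := List.length_pos_iff.2 hw
      omega
    simp only [Φ.satisfied_iff_not_derives hn, H, Set.mem_ofPred_eq, e.symm_apply_apply]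
    rfl
  rw [language_eq]
  refine setOf_mem_diagonalGridLanguages_of_determined H (fun {w w' x x' d d'} h_left h_below => ?_)
    (fun {w w' x x'} h_letter h_left => ?_) _
  · rw [leftValue_eq_iff] at h_left
    rw [H_eq_iff] at h_below ⊢
    refine .inner hK hdepth (Nat.le_add_right _ _) (Nat.le_add_right _ _) (fun hx => ?_) h_below
    have := H_eq_iff.1 (h_left.2 hx)
    rwa [show x - 1 + (d + 2) = x + d + 1 by omega,
      show x' - 1 + (d' + 2) = x' + d' + 1 by omega] at this
  · rw [leftValue_eq_iff] at h_left
    rw [H_eq_iff]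
    refine .diagonal hK hdepth h_left.1 (fun hx => ?_) h_letter
    have := H_eq_iff.1 (h_left.2 hx)
    rwa [show x - 1 + 1 = x by omega, show x' - 1 + 1 = x' by omega] at this

theorem diagonalGridLanguages_eq_predDioESOHorn (A : Type*) [Finite A] :
    DiagonalGridLanguages A = PredDioESOHorn A := by
  refine Set.Subset.antisymm ?_ ?_
  · rintro _ ⟨G, rfl⟩
    exact ⟨G.toFormula, G.language_toFormula.symm⟩
  · rintro _ ⟨Φ, rfl⟩
    exact Φ.language_mem_diagonalGridLanguages

theorem mainTheorem2 (A : Type*) [Finite A] : RealTimeIA A = PredDioESOHorn A :=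
  (realTimeIA_eq_diagonalGridLanguages A).trans (diagonalGridLanguages_eq_predDioESOHorn A)
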